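/- **Theorem (Stability lemma).** Let $G$ be a finite graph with vertex set $[n]$, regarded as the complete graph on $[n]$ in which each vertex $i$ has weight $x-r_i$ with $r_i\in\mathbb R$ and each edge $jk$ has a real weight $\lambda_{jk}\le 0$; vertices $j\ne k$ are *neighbors* if $\lambda_{jk}\neq 0$. The weighted matching polynomial of $G$ is $$\mu(G)(x)=\sum_{M}\ \prod_{i\notin M}(x-r_i)\prod_{jk\in M}\lambda_{jk},$$ where $M$ ranges over the matchings of $G$ (sets of pairwise disjoint edges) and $i\notin M$ means that the vertex $i$ is not covered by $M$; in particular $\mu(\emptyset)=1$. For a vertex $i$ let $G\setminus i$ be the graph obtained by deleting $i$, and let $\alpha_i(G)=\mu(G)/\mu(G\setminus i)$, a real rational function, whose values at real points are taken in $\mathbb R\cup\{\infty\}$ (the value is $\infty$ at a pole). For $\theta\in\mathbb R$ let $-_{\theta,G}$, $0_{\theta,G}$, $+_{\theta,G}$ and $\infty_{\theta,G}$ be the sets of vertices $i$ of $G$ for which $\alpha_i(G)(\theta)$ is negative, zero, positive and infinite, respectively. Let $m_\theta(G)$ be the multiplicity of $\theta$ as a zero of $\mu(G)$; a vertex $i$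 is *$\theta$-essential* if $m_\theta(G\setminus i)=m_\theta(G)-1$. The *frontier* $\partial A$ of a set $A$ of vertices is the set of vertices that are not in $A$ but have a neighbor in $A$. Then $0_{\theta,G}$ is the set of $\theta$-essential vertices of $G$. Moreover, if $i\in\partial 0_{\theta,G}$, then for every vertex $j\neq i$ $$\alpha_j(G\setminus i)(\theta)=\alpha_j(G)(\theta),\qquad\text{that is,}\qquad \frac{\mu(G\setminus i)}{\mu(G\setminus i,j)}(\theta)=\frac{\mu(G)}{\mu(G\setminus j)}(\theta),$$ as elements of $\mathbb R\cup\{\infty\}$. Consequently $$-_{\theta,G\setminus i}=-_{\theta,G},\qquad 0_{\theta,G\setminus i}=0_{\theta,G},\qquad +_{\theta,G\setminus i}=+_{\theta,G},\qquad \infty_{\theta,G\setminus i}=\infty_{\theta,G}\setminus\{i\}.$$ -/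

import Mathlib

open Polynomial

/-- A finite weighted graph with vertices in `V`. It is regarded as the complete graph on the finite
set `verts`, the vertex `i` carrying the weight `x - r i` and the edge `jk` the non-positive weight
`lam s(j, k)`. An edge of weight zero counts as non-existent. The values of `r` outside `verts`, and
of `lam` on loops or on pairs that are not contained in `verts`, play no role. -/
structure WGraph (V : Type*) where
  verts : Finset V
  r : V → ℝ
  lam : Sym2 V → ℝ
  lam_nonpos : ∀ e, lam e ≤ 0

namespace WGraph

variable {V : Type*} [DecidableEq V]

/-- Vertex deletion `G ∖ i`. -/
def delete (G : WGraph V) (i : V) : WGraph V := { G with verts := G.verts.erase i }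

/-- Two vertices are neighbors if the edge between them has non-zero weight. -/
def Adj (G : WGraph V) (i j : V) : Prop :=
  i ∈ G.verts ∧ j ∈ G.verts ∧ i ≠ j ∧ G.lam s(i, j) ≠ 0

/-- The edges of the complete graph on the vertex set of `G`. -/
def edges (G : WGraph V) : Finset (Sym2 V) := G.verts.sym2.filter fun e => ¬ e.IsDiag

/-- The matchings: sets of edges, no two of which have a vertex in common. -/
def matchings (G : WGraph V) : Finset (Finset (Sym2 V)) :=
  G.edges.powerset.filter fun M => ∀ e ∈ M, ∀ f ∈ M, e ≠ f → Disjoint e.toFinset f.toFinset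

/-- The vertices of `G` that are not covered by `M`. -/
def uncovered (G : WGraph V) (M : Finset (Sym2 V)) : Finset V :=
  G.verts.filter fun v => ∀ e ∈ M, v ∉ e

/-- The weighted matching polynomial `μ(G)`. -/
noncomputable def mu (G : WGraph V) : ℝ[X] :=
  ∑ M ∈ G.matchings, (∏ i ∈ G.uncovered M, (X - C (G.r i))) * ∏ e ∈ M, C (G.lam e)

/-- The multiplicity `m_θ(G)` of `θ` as a zero of `μ(G)`. -/
noncomputable def mult (G : WGraph V) (θ : ℝ) : ℕ := G.mu.rootMultiplicity θ

/-- The graph continued fraction `α_i(G) = μ(G) / μ(G ∖ i)`, a real rational function. -/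
noncomputable def alpha (G : WGraph V) (i : V) : RatFunc ℝ :=
  algebraMap ℝ[X] (RatFunc ℝ) G.mu / algebraMap ℝ[X] (RatFunc ℝ) (G.delete i).mu

end WGraph

open Classical in
/-- The value of a real rational function at a real point, in `ℝ ∪ {∞}`: it is `∞` at the poles,
that is, at the zeros of the denominator in lowest terms. -/
noncomputable def RatFunc.valueAt (f : RatFunc ℝ) (θ : ℝ) : OnePoint ℝ :=
  if f.denom.eval θ = 0 then OnePoint.infty else ((f.num.eval θ / f.denom.eval θ : ℝ) : OnePoint ℝ)

namespace WGraph

variable {V : Type*} [DecidableEq V]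

/-- The set `-_{θ,G}`. -/
def negSet (G : WGraph V) (θ : ℝ) : Set V :=
  {i | i ∈ G.verts ∧ ∃ t : ℝ, t < 0 ∧ (G.alpha i).valueAt θ = (t : OnePoint ℝ)}

/-- The set `0_{θ,G}`. -/
def zeroSet (G : WGraph V) (θ : ℝ) : Set V :=
  {i | i ∈ G.verts ∧ (G.alpha i).valueAt θ = ((0 : ℝ) : OnePoint ℝ)}

/-- The set `+_{θ,G}`. -/
def posSet (G : WGraph V) (θ : ℝ) : Set V :=
  {i | i ∈ G.verts ∧ ∃ t : ℝ, 0 < t ∧ (G.alpha i).valueAt θ = (t : OnePoint ℝ)}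

/-- The set `∞_{θ,G}`. -/
def inftySet (G : WGraph V) (θ : ℝ) : Set V :=
  {i | i ∈ G.verts ∧ (G.alpha i).valueAt θ = OnePoint.infty}

/-- The set of `θ`-essential vertices: those with `m_θ(G ∖ i) = m_θ(G) - 1`. -/
def essentialSet (G : WGraph V) (θ : ℝ) : Set V :=
  {i | i ∈ G.verts ∧ (G.delete i).mult θ + 1 = G.mult θ}

/-- The frontier `∂A`: the vertices that are not in `A` but have a neighbor in `A`. -/
def boundary (G : WGraph V) (A : Set V) : Set V :=
  {i | i ∈ G.verts ∧ i ∉ A ∧ ∃ j ∈ A, G.Adj i j}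

end WGraph

/-!
The key object is `cross G i j = μ(G ∖ i) μ(G ∖ j) - μ(G) μ(G ∖ i, j)`. The recurrence `mu_eq` for
`μ` at a vertex gives, by induction, that `cross G i j` is at every real point at least
`-λ_ij μ(G ∖ i, j)²`, hence non-negative (`edge_le_cross`). A real polynomial that is non-negative
on the line vanishes to even order everywhere. The Wronskian of `μ(G)` and `μ(G ∖ i)` is treated in
the same way, and this gives `|m(G) - m(G ∖ i)| ≤ 1`, where `m` is the multiplicity of `θ`. Thus the
zeros of `α_i` at `θ` are the essential vertices.

Let `j` be essential, `i` inessential and adjacent to `j`, and `m = m(G)`. As the order of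
`cross G i j` is even, `m(G ∖ i) = m + 1` (`mult_delete_of_adj_essential`). The main step
(`mult_delete_delete_of_adj_essential`) is `m(G ∖ i, k) = m(G ∖ k) + 1` for all `k ≠ i`. In most
cases `j` is still essential and `i` inessential in `G ∖ k`, and the previous fact applies to
`G ∖ k`. What remains is to exclude that `m(G ∖ k) = m + 1` and `m(G ∖ i, k) = m`. To this end let
the weight of `k` vary: `cross G i j` becomes a quadratic polynomial in the parameter `t`, which is
non-negative, so its discriminant is non-positive. The linear coefficient is a combination of four
products (`cross₃`), one of which has order `2 m - 1` and the others larger order, while the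
discriminant inequality forces order at least `2 m`.

Zeros and poles of `α_k` are hence the same for `G` and `G ∖ i`. If `α_k(G)` is finite and non-zero
at `θ`, then `α_k(G ∖ i) - α_k(G)` is the quotient of `cross G i k`, of order at least `2 m + 2` by
parity, and of a polynomial of order `2 m + 1`; so it vanishes at `θ`.
-/

/-! ### Orders of vanishing of real polynomials -/

namespace Polynomial

theorem le_rootMultiplicity_add {p q : ℝ[X]} {θ : ℝ} {n : ℕ} (hp : p ≠ 0) (hq : q ≠ 0)
    (h : (X - C θ) ^ n ∣ p * q) : n ≤ p.rootMultiplicity θ + q.rootMultiplicity θ := by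
  rw [← rootMultiplicity_mul (mul_ne_zero hp hq)]
  exact (le_rootMultiplicity_iff (mul_ne_zero hp hq)).2 h

theorem pow_dvd_mul_of_le {p q : ℝ[X]} {θ : ℝ} {n : ℕ}
    (h : n ≤ p.rootMultiplicity θ + q.rootMultiplicity θ) : (X - C θ) ^ n ∣ p * q :=
  (pow_dvd_pow _ h).trans <| by
    rw [pow_add]
    exact mul_dvd_mul (pow_rootMultiplicity_dvd p θ) (pow_rootMultiplicity_dvd q θ)

theorem eval_nonneg_of_nonneg_on_punctured {q : ℝ[X]} {θ : ℝ} {s : Set ℝ} [(nhdsWithin θ s).NeBot]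
    (h : ∀ x ∈ s, 0 ≤ q.eval x) : 0 ≤ q.eval θ :=
  ge_of_tendsto (q.continuous.continuousWithinAt (s := s) (x := θ))
    (Filter.eventually_of_mem self_mem_nhdsWithin h)

/-- A polynomial that is non-negative on `ℝ` does not vanish to odd order. -/
theorem pow_succ_dvd_of_nonneg {p : ℝ[X]} {θ : ℝ} {n : ℕ} (hn : Odd n)
    (hp : ∀ x, 0 ≤ p.eval x) (h : (X - C θ) ^ n ∣ p) : (X - C θ) ^ (n + 1) ∣ p := by
  obtain ⟨q, rfl⟩ := h
  simp only [eval_mul, eval_pow, eval_sub, eval_X, eval_C] at hp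
  have h1 : 0 ≤ q.eval θ := eval_nonneg_of_nonneg_on_punctured (s := Set.Ioi θ) fun x hx =>
    nonneg_of_mul_nonneg_right (hp x) (pow_pos (sub_pos.2 hx) n)
  have h2 : 0 ≤ (-q).eval θ := eval_nonneg_of_nonneg_on_punctured (s := Set.Iio θ) fun x hx => by
    rw [eval_neg, neg_nonneg]
    exact nonpos_of_mul_nonneg_right (hp x) (hn.pow_neg (sub_neg.2 hx))
  rw [eval_neg] at h2
  rw [pow_succ]
  exact mul_dvd_mul_left _ (dvd_iff_isRoot.2 (le_antisymm (by linarith) h1))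

/-- If `f ^ 2 ≤ g` on `ℝ`, then `g` vanishes at most twice as often as `f`. -/
theorem le_two_mul_rootMultiplicity {f g : ℝ[X]} {θ : ℝ} {n : ℕ} (hf : f ≠ 0)
    (hfg : ∀ x, f.eval x ^ 2 ≤ g.eval x) (h : (X - C θ) ^ n ∣ g) :
    n ≤ 2 * f.rootMultiplicity θ := by
  by_contra! hlt
  obtain ⟨q, hq, hq0⟩ := exists_eq_pow_rootMultiplicity_mul_and_not_dvd f hf θ
  set k := f.rootMultiplicity θ
  obtain ⟨u, rfl⟩ := (pow_dvd_pow (X - C θ) (show 2 * k + 1 ≤ n by omega)).trans h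
  have h1 : 0 ≤ ((X - C θ) * u - q ^ 2).eval θ :=
    eval_nonneg_of_nonneg_on_punctured (s := {θ}ᶜ) fun x hx => by
      have hx' : x - θ ≠ 0 := sub_ne_zero.2 hx
      have h2 : 0 < (x - θ) ^ (2 * k) := (even_two_mul k).pow_pos hx'
      have h3 := hfg x
      rw [hq] at h3
      simp only [eval_mul, eval_pow, eval_sub, eval_X, eval_C] at h3 ⊢
      refine nonneg_of_mul_nonneg_right (a := (x - θ) ^ (2 * k)) ?_ h2
      have h4 : (x - θ) ^ (2 * k) * ((x - θ) * u.eval x - q.eval x ^ 2) =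
          (x - θ) ^ (2 * k + 1) * u.eval x - ((x - θ) ^ k * q.eval x) ^ 2 := by ring
      rw [h4]
      exact sub_nonneg.2 h3
  simp only [eval_sub, eval_mul, eval_pow, eval_X, eval_C, sub_self, zero_mul, zero_sub] at h1
  have h5 : q.eval θ = 0 := by
    have := sq_nonneg (q.eval θ)
    exact pow_eq_zero_iff (two_ne_zero) |>.1 (by linarith)
  exact hq0 (dvd_iff_isRoot.2 h5)

theorem pow_pred_dvd_derivative {p : ℝ[X]} {θ : ℝ} {n : ℕ} (h : (X - C θ) ^ n ∣ p) :
    (X - C θ) ^ (n - 1) ∣ derivative p := by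
  obtain ⟨q, rfl⟩ := h
  rw [derivative_mul]
  refine dvd_add (Dvd.dvd.mul_right ?_ _) (Dvd.dvd.mul_right (pow_dvd_pow _ (by omega)) _)
  rw [derivative_X_sub_C_pow]
  exact dvd_mul_left _ _

/-- The Wronskian of `p` and `q` vanishes at least to the order of `p * q` minus one. -/
theorem pow_dvd_wronskian {p q : ℝ[X]} {θ : ℝ} {n : ℕ}
    (h : n + 1 ≤ p.rootMultiplicity θ + q.rootMultiplicity θ) :
    (X - C θ) ^ n ∣ derivative p * q - p * derivative q := by
  have key : ∀ p q : ℝ[X], n + 1 ≤ p.rootMultiplicity θ + q.rootMultiplicity θ →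
      (X - C θ) ^ n ∣ derivative p * q := fun p q h => by
    refine (pow_dvd_pow _
      (show n ≤ p.rootMultiplicity θ - 1 + q.rootMultiplicity θ by omega)).trans ?_
    rw [pow_add]
    exact mul_dvd_mul (pow_pred_dvd_derivative (pow_rootMultiplicity_dvd p θ))
      (pow_rootMultiplicity_dvd q θ)
  rw [mul_comm p]
  exact dvd_sub (key p q h) (key q p (by omega))

end Polynomial

/-! ### Values of quotients of polynomials -/

namespace RatFunc

variable {p q p' q' : ℝ[X]} {θ : ℝ}

theorem num_div_mul_eq (hq : q ≠ 0) :
    (algebraMap ℝ[X] (RatFunc ℝ) p / algebraMap ℝ[X] (RatFunc ℝ) q).num * q =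
      p * (algebraMap ℝ[X] (RatFunc ℝ) p / algebraMap ℝ[X] (RatFunc ℝ) q).denom :=
  (num_mul_eq_mul_denom_iff hq).2 rfl

theorem num_algebraMap_div_ne_zero (hp : p ≠ 0) (hq : q ≠ 0) :
    (algebraMap ℝ[X] (RatFunc ℝ) p / algebraMap ℝ[X] (RatFunc ℝ) q).num ≠ 0 := by
  intro h
  have := num_div_mul_eq (p := p) hq
  rw [h, zero_mul] at this
  exact mul_ne_zero hp (denom_ne_zero _) this.symm

theorem rootMultiplicity_num_add (hp : p ≠ 0) (hq : q ≠ 0) (θ : ℝ) :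
    (algebraMap ℝ[X] (RatFunc ℝ) p / algebraMap ℝ[X] (RatFunc ℝ) q).num.rootMultiplicity θ +
        q.rootMultiplicity θ =
      p.rootMultiplicity θ +
        (algebraMap ℝ[X] (RatFunc ℝ) p /
          algebraMap ℝ[X] (RatFunc ℝ) q).denom.rootMultiplicity θ := by
  rw [← rootMultiplicity_mul (mul_ne_zero (num_algebraMap_div_ne_zero hp hq) hq),
    ← rootMultiplicity_mul (mul_ne_zero hp (denom_ne_zero _)), num_div_mul_eq hq]

theorem not_eval_num_and_denom_eq_zero (f : RatFunc ℝ) (θ : ℝ) :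
    ¬ (f.num.eval θ = 0 ∧ f.denom.eval θ = 0) := by
  rintro ⟨h1, h2⟩
  obtain ⟨a, b, h⟩ := f.isCoprime_num_denom
  have := congrArg (Polynomial.eval θ) h
  simp [h1, h2] at this

theorem eval_denom_div_eq_zero_iff (hp : p ≠ 0) (hq : q ≠ 0) :
    (algebraMap ℝ[X] (RatFunc ℝ) p / algebraMap ℝ[X] (RatFunc ℝ) q).denom.eval θ = 0 ↔
      p.rootMultiplicity θ < q.rootMultiplicity θ := by
  have h := rootMultiplicity_num_add hp hq θ
  have h1 := not_eval_num_and_denom_eq_zero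
    (algebraMap ℝ[X] (RatFunc ℝ) p / algebraMap ℝ[X] (RatFunc ℝ) q) θ
  have h2 := rootMultiplicity_pos (x := θ) (num_algebraMap_div_ne_zero hp hq)
  have h3 := rootMultiplicity_pos (x := θ)
    (denom_ne_zero (algebraMap ℝ[X] (RatFunc ℝ) p / algebraMap ℝ[X] (RatFunc ℝ) q))
  rw [IsRoot] at h2 h3
  rw [← h2, ← h3] at h1
  rw [← h3]
  omega

theorem eval_num_div_eq_zero_iff (hp : p ≠ 0) (hq : q ≠ 0) :
    (algebraMap ℝ[X] (RatFunc ℝ) p / algebraMap ℝ[X] (RatFunc ℝ) q).num.eval θ = 0 ↔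
      q.rootMultiplicity θ < p.rootMultiplicity θ := by
  have h := rootMultiplicity_num_add hp hq θ
  have h1 := not_eval_num_and_denom_eq_zero
    (algebraMap ℝ[X] (RatFunc ℝ) p / algebraMap ℝ[X] (RatFunc ℝ) q) θ
  have h2 := rootMultiplicity_pos (x := θ) (num_algebraMap_div_ne_zero hp hq)
  have h3 := rootMultiplicity_pos (x := θ)
    (denom_ne_zero (algebraMap ℝ[X] (RatFunc ℝ) p / algebraMap ℝ[X] (RatFunc ℝ) q))
  rw [IsRoot] at h2 h3
  rw [← h2, ← h3] at h1
  rw [← h2]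
  omega

theorem valueAt_div_eq_infty_iff (hp : p ≠ 0) (hq : q ≠ 0) :
    (algebraMap ℝ[X] (RatFunc ℝ) p / algebraMap ℝ[X] (RatFunc ℝ) q).valueAt θ = OnePoint.infty ↔
      p.rootMultiplicity θ < q.rootMultiplicity θ := by
  rw [← eval_denom_div_eq_zero_iff hp hq, valueAt]
  split_ifs with h <;> simp [h]

theorem valueAt_div_eq_zero_iff (hp : p ≠ 0) (hq : q ≠ 0) :
    (algebraMap ℝ[X] (RatFunc ℝ) p / algebraMap ℝ[X] (RatFunc ℝ) q).valueAt θ =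
        ((0 : ℝ) : OnePoint ℝ) ↔
      q.rootMultiplicity θ < p.rootMultiplicity θ := by
  have h1 := eval_denom_div_eq_zero_iff (θ := θ) hp hq
  rw [← eval_num_div_eq_zero_iff hp hq, valueAt]
  split_ifs with h
  · exact iff_of_false (OnePoint.infty_ne_coe _)
      fun h' => not_eval_num_and_denom_eq_zero _ θ ⟨h', h⟩
  · rw [OnePoint.coe_eq_coe, div_eq_zero_iff]
    simp [h]

/-- Two quotients `p / q` and `p' / q'` without a pole at `θ` have the same value there if
their difference `(p * q' - p' * q) / (q * q')` vanishes at `θ`. -/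
theorem valueAt_div_congr (hp : p ≠ 0) (hq : q ≠ 0) (hp' : p' ≠ 0) (hq' : q' ≠ 0)
    (h : q.rootMultiplicity θ ≤ p.rootMultiplicity θ)
    (h' : q'.rootMultiplicity θ ≤ p'.rootMultiplicity θ)
    (hd : (Polynomial.X - Polynomial.C θ) ^ (q.rootMultiplicity θ + q'.rootMultiplicity θ + 1) ∣
      p * q' - p' * q) :
    (algebraMap ℝ[X] (RatFunc ℝ) p / algebraMap ℝ[X] (RatFunc ℝ) q).valueAt θ =
      (algebraMap ℝ[X] (RatFunc ℝ) p' / algebraMap ℝ[X] (RatFunc ℝ) q').valueAt θ := by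
  have e := num_div_mul_eq (p := p) hq
  have e' := num_div_mul_eq (p := p') hq'
  have h1 := mt (eval_denom_div_eq_zero_iff (θ := θ) hp hq).1 h.not_gt
  have h1' := mt (eval_denom_div_eq_zero_iff (θ := θ) hp' hq').1 h'.not_gt
  rw [valueAt, valueAt, if_neg h1, if_neg h1', OnePoint.coe_eq_coe, div_eq_div_iff h1 h1',
    ← sub_eq_zero]
  generalize algebraMap ℝ[X] (RatFunc ℝ) p / algebraMap ℝ[X] (RatFunc ℝ) q = f at *
  generalize algebraMap ℝ[X] (RatFunc ℝ) p' / algebraMap ℝ[X] (RatFunc ℝ) q' = f' at *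
  have h2 : (q * q') * (f.num * f'.denom - f'.num * f.denom) =
      (p * q' - p' * q) * (f.denom * f'.denom) := by
    linear_combination q' * f'.denom * e - q * f.denom * e'
  by_cases h0 : f.num * f'.denom - f'.num * f.denom = 0
  · simpa using congrArg (Polynomial.eval θ) h0
  · have h3 := le_rootMultiplicity_add (mul_ne_zero hq hq') h0 (h2 ▸ hd.mul_right _)
    rw [rootMultiplicity_mul (mul_ne_zero hq hq')] at h3
    have h4 := (rootMultiplicity_pos h0 (x := θ)).1 (by omega)
    simpa [IsRoot] using h4

end RatFunc

/-! ### The recurrence for the matching polynomial -/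

namespace WGraph

variable {V : Type*} [DecidableEq V]

theorem delete_comm (G : WGraph V) (i j : V) :
    (G.delete i).delete j = (G.delete j).delete i := by
  simp only [delete, Finset.erase_right_comm]

theorem mem_edges {G : WGraph V} {e : Sym2 V} :
    e ∈ G.edges ↔ (∀ v ∈ e, v ∈ G.verts) ∧ ¬ e.IsDiag := by
  simp [edges, Finset.mem_sym2_iff]

theorem mem_matchings {G : WGraph V} {M : Finset (Sym2 V)} :
    M ∈ G.matchings ↔ (∀ e ∈ M, e ∈ G.edges) ∧
      ∀ e ∈ M, ∀ f ∈ M, ∀ v, v ∈ e → v ∈ f → e = f := by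
  simp only [matchings, Finset.mem_filter, Finset.mem_powerset, Finset.subset_iff,
    Finset.disjoint_left, Sym2.mem_toFinset]
  refine and_congr Iff.rfl ⟨fun h e he f hf v hv hv' => ?_, fun h e he f hf hne v hv hv' => ?_⟩
  · by_contra hne
    exact h e he f hf hne hv hv'
  · exact hne (h e he f hf v hv hv')

theorem mem_uncovered {G : WGraph V} {M : Finset (Sym2 V)} {v : V} :
    v ∈ G.uncovered M ↔ v ∈ G.verts ∧ ∀ e ∈ M, v ∉ e := by
  simp [uncovered]

theorem mem_delete {G : WGraph V} {i v : V} :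
    v ∈ (G.delete i).verts ↔ v ≠ i ∧ v ∈ G.verts := by
  simp [delete]

/-- The matchings of `G ∖ i` are the matchings of `G` that do not cover `i`. -/
theorem matchings_delete {G : WGraph V} {i : V} (hi : i ∈ G.verts) :
    (G.delete i).matchings = G.matchings.filter (fun M => i ∈ G.uncovered M) := by
  ext M
  simp only [Finset.mem_filter, mem_matchings, mem_edges, mem_uncovered, mem_delete]
  constructor
  · rintro ⟨h1, h2⟩
    exact ⟨⟨fun e he => ⟨fun v hv => ((h1 e he).1 v hv).2, (h1 e he).2⟩, h2⟩, hi,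
      fun e he hv => ((h1 e he).1 i hv).1 rfl⟩
  · rintro ⟨⟨h1, h2⟩, -, h3⟩
    exact ⟨fun e he => ⟨fun v hv => ⟨fun h => h3 e he (h ▸ hv), (h1 e he).1 v hv⟩,
      (h1 e he).2⟩, h2⟩

/-- The contribution of the matching `M` to `μ(G)`. -/
noncomputable def term (G : WGraph V) (M : Finset (Sym2 V)) : ℝ[X] :=
  (∏ i ∈ G.uncovered M, (X - C (G.r i))) * ∏ e ∈ M, C (G.lam e)

theorem term_of_mem_uncovered {G : WGraph V} {i : V} {M : Finset (Sym2 V)}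
    (h : i ∈ G.uncovered M) :
    G.term M = (X - C (G.r i)) * (G.delete i).term M := by
  have : (G.delete i).uncovered M = (G.uncovered M).erase i := by
    ext v
    simp only [mem_uncovered, mem_delete, Finset.mem_erase]
    tauto
  rw [term, term, this, ← Finset.mul_prod_erase _ _ h, mul_assoc]
  rfl

theorem edge_notMem_of_mem_matchings {G : WGraph V} {i l : V} {M : Finset (Sym2 V)}
    (hM : M ∈ ((G.delete i).delete l).matchings) : s(i, l) ∉ M := by
  intro h
  have := (mem_edges.1 ((mem_matchings.1 hM).1 _ h)).1 i (Sym2.mem_mk_left i l)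
  simp [mem_delete] at this

theorem term_insert {G : WGraph V} {i l : V} {M : Finset (Sym2 V)}
    (hM : M ∈ ((G.delete i).delete l).matchings) :
    G.term (insert s(i, l) M) = C (G.lam s(i, l)) * ((G.delete i).delete l).term M := by
  have : G.uncovered (insert s(i, l) M) = ((G.delete i).delete l).uncovered M := by
    ext v
    simp only [mem_uncovered, mem_delete, Finset.forall_mem_insert, Sym2.mem_iff]
    tauto
  rw [term, term, this, Finset.prod_insert (edge_notMem_of_mem_matchings hM)]
  simp only [delete]
  ring

theorem insert_mem_matchings {G : WGraph V} {i l : V} (hi : i ∈ G.verts) (hl : l ∈ G.verts)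
    (hil : l ≠ i) {M : Finset (Sym2 V)} (hM : M ∈ ((G.delete i).delete l).matchings) :
    insert s(i, l) M ∈ G.matchings := by
  rw [mem_matchings] at hM ⊢
  obtain ⟨h1, h2⟩ := hM
  simp only [mem_edges, mem_delete] at h1
  have h3 : ∀ e ∈ M, ∀ v ∈ e, v ∉ s(i, l) := by
    intro e he v hv
    have := (h1 e he).1 v hv
    simp only [Sym2.mem_iff]
    tauto
  constructor
  · intro e he
    rw [mem_edges]
    rcases Finset.mem_insert.1 he with rfl | he
    · refine ⟨fun v hv => ?_, ?_⟩
      · rcases Sym2.mem_iff.1 hv with rfl | rfl <;> assumption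
      · simpa using hil.symm
    · exact ⟨fun v hv => ((h1 e he).1 v hv).2.2, (h1 e he).2⟩
  · intro e he f hf v hve hvf
    rcases Finset.mem_insert.1 he with rfl | he <;> rcases Finset.mem_insert.1 hf with rfl | hf
    · rfl
    · exact absurd hve (h3 f hf v hvf)
    · exact absurd hvf (h3 e he v hve)
    · exact h2 e he f hf v hve hvf

theorem erase_mem_matchings {G : WGraph V} {i l : V} {M : Finset (Sym2 V)}
    (hM : M ∈ G.matchings) (he : s(i, l) ∈ M) :
    M.erase s(i, l) ∈ ((G.delete i).delete l).matchings := by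
  rw [mem_matchings] at hM ⊢
  obtain ⟨h1, h2⟩ := hM
  simp only [mem_edges] at h1
  refine ⟨fun e h' => ?_, fun e h f hf => h2 e (Finset.mem_of_mem_erase h) f
    (Finset.mem_of_mem_erase hf)⟩
  obtain ⟨hne, h⟩ := Finset.mem_erase.1 h'
  rw [mem_edges]
  refine ⟨fun v hv => ?_, (h1 e h).2⟩
  rw [mem_delete, mem_delete]
  refine ⟨?_, ?_, (h1 e h).1 v hv⟩
  · rintro rfl
    exact hne (h2 e h _ he v hv (Sym2.mem_mk_right _ _))
  · rintro rfl
    exact hne (h2 e h _ he v hv (Sym2.mem_mk_left _ _))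

/-- The matchings covering `i`, sorted by the partner of `i`. -/
theorem filter_covered_eq_biUnion {G : WGraph V} {i : V} (hi : i ∈ G.verts) :
    G.matchings.filter (fun M => ¬ i ∈ G.uncovered M) =
      (G.verts.erase i).biUnion fun l =>
        ((G.delete i).delete l).matchings.image (insert s(i, l)) := by
  ext M
  simp only [Finset.mem_filter, Finset.mem_biUnion, Finset.mem_image, Finset.mem_erase]
  constructor
  · rintro ⟨hM, hc⟩
    simp only [mem_uncovered, hi, true_and, not_forall, not_not] at hc
    obtain ⟨e, he, hie⟩ := hc
    obtain ⟨l, rfl⟩ := Sym2.mem_iff_exists.1 hie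
    have h1 := mem_edges.1 ((mem_matchings.1 hM).1 _ he)
    refine ⟨l, ⟨?_, h1.1 l (Sym2.mem_mk_right _ _)⟩, _, erase_mem_matchings hM he,
      Finset.insert_erase he⟩
    rintro rfl
    exact h1.2 (by simp)
  · rintro ⟨l, ⟨hli, hl⟩, M, hM, rfl⟩
    refine ⟨insert_mem_matchings hi hl hli hM, fun h => ?_⟩
    exact (mem_uncovered.1 h).2 _ (Finset.mem_insert_self _ _) (Sym2.mem_mk_left _ _)

/-- The recurrence for the matching polynomial at the vertex `i`: either `i` is uncovered, or it is
matched to some `l`. -/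
theorem mu_eq {G : WGraph V} {i : V} (hi : i ∈ G.verts) :
    G.mu = (X - C (G.r i)) * (G.delete i).mu +
      ∑ l ∈ G.verts.erase i, C (G.lam s(i, l)) * ((G.delete i).delete l).mu := by
  have hmu : ∀ H : WGraph V, H.mu = ∑ M ∈ H.matchings, H.term M := fun _ => rfl
  simp only [hmu, Finset.mul_sum]
  rw [← Finset.sum_filter_add_sum_filter_not G.matchings (fun M => i ∈ G.uncovered M),
    filter_covered_eq_biUnion hi, Finset.sum_biUnion, matchings_delete hi]
  · congr 1
    · exact Finset.sum_congr rfl fun M hM => term_of_mem_uncovered (Finset.mem_filter.1 hM).2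
    · refine Finset.sum_congr rfl fun l hl => ?_
      rw [Finset.sum_image]
      · exact Finset.sum_congr rfl fun M hM => term_insert hM
      · intro M hM N hN h
        have h' := congrArg (fun S => S.erase s(i, l)) h
        simpa only [Finset.erase_insert (edge_notMem_of_mem_matchings hM),
          Finset.erase_insert (edge_notMem_of_mem_matchings hN)] using h'
  · intro l hl k hk hlk
    rw [Function.onFun, Finset.disjoint_left]
    intro M hM hM'
    obtain ⟨A, hA, rfl⟩ := Finset.mem_image.1 hM
    obtain ⟨B, hB, hAB⟩ := Finset.mem_image.1 hM'
    have hl' := Finset.mem_erase.1 hl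
    have h := (mem_matchings.1 (insert_mem_matchings hi hl'.2 hl'.1 hA)).2 s(i, l)
      (Finset.mem_insert_self _ _) s(i, k) (hAB ▸ Finset.mem_insert_self _ _) i
      (Sym2.mem_mk_left _ _) (Sym2.mem_mk_left _ _)
    exact hlk (Sym2.congr_right.1 h)

theorem mu_of_verts_eq_empty {G : WGraph V} (h : G.verts = ∅) : G.mu = 1 := by
  have h1 : G.edges = ∅ := by simp [edges, h]
  have h2 : G.matchings = {∅} := by
    rw [matchings, h1]
    ext M
    simp only [Finset.powerset_empty, Finset.mem_filter, Finset.mem_singleton]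
    exact ⟨fun h => h.1, fun h => ⟨h, by simp [h]⟩⟩
  simp [mu, h2, uncovered, h]

/-- The matching polynomial depends on the vertex weights of the vertices of `G` only. -/
theorem mu_update_r {G : WGraph V} {k : V} (hk : k ∉ G.verts) (t : ℝ) :
    ({ G with r := Function.update G.r k t } : WGraph V).mu = G.mu := by
  refine Finset.sum_congr rfl fun M _ => ?_
  congr 1
  refine Finset.prod_congr rfl fun v hv => ?_
  have : v ≠ k := by
    rintro rfl
    exact hk (mem_uncovered.1 hv).1
  simp [this]

/-- The graph in which the weight of `k` has been lowered from `x - r k` to `x - r k - t`. -/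
def shift (G : WGraph V) (k : V) (t : ℝ) : WGraph V :=
  { G with r := Function.update G.r k (G.r k + t) }

theorem mu_shift_of_notMem {G : WGraph V} {k : V} (hk : k ∉ G.verts) (t : ℝ) :
    (G.shift k t).mu = G.mu :=
  mu_update_r hk _

theorem mu_shift {G : WGraph V} {k : V} (hk : k ∈ G.verts) (t : ℝ) :
    (G.shift k t).mu = G.mu - C t * (G.delete k).mu := by
  have hd : ((G.shift k t).delete k).mu = (G.delete k).mu :=
    mu_shift_of_notMem (G := G.delete k) (by simp [delete]) t
  have hdd : ∀ l, (((G.shift k t).delete k).delete l).mu = ((G.delete k).delete l).mu :=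
    fun l => mu_shift_of_notMem (G := (G.delete k).delete l) (by simp [delete]) t
  rw [mu_eq (G := G.shift k t) (i := k) hk, mu_eq hk, hd]
  simp only [hdd]
  simp only [shift, Function.update_self, C_add]
  ring

/-! ### Positivity of cross terms and Wronskians, interlacing -/

/-- The polynomial `μ(G ∖ i) μ(G ∖ j) - μ(G) μ(G ∖ i, j)`, the numerator of
`α_j(G ∖ i) - α_j(G)`. -/
noncomputable def cross (G : WGraph V) (i j : V) : ℝ[X] :=
  (G.delete i).mu * (G.delete j).mu - G.mu * ((G.delete i).delete j).mu

theorem cross_eq {G : WGraph V} {i j : V} (hi : i ∈ G.verts) (hj : j ∈ G.verts) (hij : i ≠ j) :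
    G.cross i j = ∑ l ∈ (G.verts.erase i).erase j,
        C (-G.lam s(i, l)) * (G.delete i).cross l j +
      C (-G.lam s(i, j)) * ((G.delete i).delete j).mu ^ 2 := by
  have h1 := mu_eq hi
  have h2 := mu_eq (G := G.delete j) (i := i) (by simp [delete, hi, hij])
  rw [← Finset.add_sum_erase _ _ (Finset.mem_erase.2 ⟨hij.symm, hj⟩)] at h1
  have h3 : (G.delete j).verts.erase i = (G.verts.erase i).erase j := Finset.erase_right_comm
  rw [h3, delete_comm G j i] at h2
  have h4 : (G.delete j).r = G.r := rfl
  have h5 : (G.delete j).lam = G.lam := rfl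
  rw [h4, h5] at h2
  have h6 : ∀ l, ((G.delete i).delete j).delete l = ((G.delete i).delete l).delete j :=
    fun l => delete_comm _ _ _
  simp only [h6] at h2
  simp only [cross, C_neg, neg_mul, mul_sub, Finset.sum_neg_distrib, Finset.sum_sub_distrib]
  rw [h1, h2]
  have h7 : ∀ l, C (G.lam s(i, l)) * (((G.delete i).delete l).mu * ((G.delete i).delete j).mu) =
    (C (G.lam s(i, l)) * ((G.delete i).delete l).mu) * ((G.delete i).delete j).mu :=
    fun l => by ring
  have h8 : ∀ l, C (G.lam s(i, l)) * ((G.delete i).mu * (((G.delete i).delete l).delete j).mu) =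
    (G.delete i).mu * (C (G.lam s(i, l)) * (((G.delete i).delete l).delete j).mu) :=
    fun l => by ring
  simp only [h7, h8, ← Finset.sum_mul, ← Finset.mul_sum]
  ring

/-- On the real line `cross G i j` dominates the contribution of the path that consists of the
edge `ij` alone; in fact it is the sum of such squares over all paths from `i` to `j`. -/
theorem edge_le_cross {n : ℕ} : ∀ {G : WGraph V} {i j : V}, G.verts.card = n → i ∈ G.verts →
    j ∈ G.verts → i ≠ j → ∀ x : ℝ,
      -G.lam s(i, j) * ((G.delete i).delete j).mu.eval x ^ 2 ≤ (G.cross i j).eval x := by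
  induction n with
  | zero =>
    intro G i j hn hi
    simp [Finset.card_eq_zero.1 hn] at hi
  | succ n ih =>
    intro G i j hn hi hj hij x
    rw [cross_eq hi hj hij]
    simp only [eval_add, eval_finsetSum, eval_mul, eval_C, eval_pow]
    refine le_add_of_nonneg_left (Finset.sum_nonneg fun l hl => ?_)
    simp only [Finset.mem_erase] at hl
    refine mul_nonneg (neg_nonneg.2 (G.lam_nonpos _)) (le_trans ?_ (ih (G := G.delete i) ?_
      (mem_delete.2 ⟨hl.2.1, hl.2.2⟩) (mem_delete.2 ⟨hij.symm, hj⟩) hl.1 x))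
    · exact mul_nonneg (neg_nonneg.2 ((G.delete i).lam_nonpos _)) (sq_nonneg _)
    · rw [delete, Finset.card_erase_of_mem hi, hn, Nat.add_sub_cancel]

theorem cross_nonneg {G : WGraph V} {i j : V} (hi : i ∈ G.verts) (hj : j ∈ G.verts)
    (hij : i ≠ j) (x : ℝ) : 0 ≤ (G.cross i j).eval x :=
  le_trans (mul_nonneg (neg_nonneg.2 (G.lam_nonpos _)) (sq_nonneg _))
    (edge_le_cross rfl hi hj hij x)

/-- The Wronskian of `μ(G)` and `μ(G ∖ i)`, the numerator of the derivative of `α_i(G)`. -/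
noncomputable def wronsk (G : WGraph V) (i : V) : ℝ[X] :=
  derivative G.mu * (G.delete i).mu - G.mu * derivative (G.delete i).mu

theorem wronsk_eq {G : WGraph V} {i : V} (hi : i ∈ G.verts) :
    G.wronsk i = (G.delete i).mu ^ 2 +
      ∑ l ∈ G.verts.erase i, C (-G.lam s(i, l)) * (G.delete i).wronsk l := by
  have h7 : ∀ l, C (G.lam s(i, l)) * (derivative (G.delete i).mu * ((G.delete i).delete l).mu) =
    derivative (G.delete i).mu * (C (G.lam s(i, l)) * ((G.delete i).delete l).mu) :=
    fun l => by ring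
  have h8 : ∀ l, C (G.lam s(i, l)) * ((G.delete i).mu * derivative ((G.delete i).delete l).mu) =
    (G.delete i).mu * (C (G.lam s(i, l)) * derivative ((G.delete i).delete l).mu) :=
    fun l => by ring
  simp only [wronsk, C_neg, neg_mul, mul_sub, Finset.sum_neg_distrib, Finset.sum_sub_distrib,
    h7, h8, ← Finset.mul_sum]
  rw [mu_eq hi]
  simp only [derivative_add, derivative_mul, derivative_sub, derivative_X, derivative_C,
    derivative_sum, zero_mul, zero_add]
  ring

theorem sq_le_wronsk {n : ℕ} : ∀ {G : WGraph V} {i : V}, G.verts.card = n → i ∈ G.verts →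
    ∀ x : ℝ, (G.delete i).mu.eval x ^ 2 ≤ (G.wronsk i).eval x := by
  induction n with
  | zero =>
    intro G i hn hi
    simp [Finset.card_eq_zero.1 hn] at hi
  | succ n ih =>
    intro G i hn hi x
    rw [wronsk_eq hi]
    simp only [eval_add, eval_finsetSum, eval_mul, eval_C, eval_pow]
    refine le_add_of_nonneg_right (Finset.sum_nonneg fun l hl => ?_)
    refine mul_nonneg (neg_nonneg.2 (G.lam_nonpos _)) (le_trans (sq_nonneg _)
      (ih (G := G.delete i) ?_ hl x))
    rw [delete, Finset.card_erase_of_mem hi, hn, Nat.add_sub_cancel]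

theorem mu_ne_zero_of_card_eq {n : ℕ} : ∀ {G : WGraph V}, G.verts.card = n → G.mu ≠ 0 := by
  induction n with
  | zero =>
    intro G hn
    rw [mu_of_verts_eq_empty (Finset.card_eq_zero.1 hn)]
    exact one_ne_zero
  | succ n ih =>
    intro G hn h
    obtain ⟨i, hi⟩ := Finset.card_pos.1 (n.succ_pos.trans_eq hn.symm)
    refine ih (G := G.delete i)
      (by rw [delete, Finset.card_erase_of_mem hi, hn, Nat.add_sub_cancel]) ?_
    refine Polynomial.funext fun x => ?_
    have h1 := sq_le_wronsk rfl hi x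
    rw [wronsk, h] at h1
    simp only [derivative_zero, zero_mul, sub_zero, eval_zero] at h1
    simpa using pow_eq_zero_iff two_ne_zero |>.1 (le_antisymm h1 (sq_nonneg _))

theorem mu_ne_zero (G : WGraph V) : G.mu ≠ 0 := mu_ne_zero_of_card_eq rfl

/-- A converse of `sq_le_wronsk`: by Cauchy–Schwarz, `μ(G)²` is at most a polynomial multiple of
the Wronskian. -/
theorem exists_sq_le_mul_wronsk {G : WGraph V} {i : V} (hi : i ∈ G.verts) :
    ∃ c : ℝ[X], ∀ x, G.mu.eval x ^ 2 ≤ (c * G.wronsk i).eval x := by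
  refine ⟨(X - C (G.r i)) ^ 2 + ∑ l ∈ G.verts.erase i, C (-G.lam s(i, l)), fun x => ?_⟩
  have hs : ∀ l ∈ G.verts.erase i, ((G.delete i).delete l).mu.eval x ^ 2 ≤
      ((G.delete i).wronsk l).eval x := fun l hl => sq_le_wronsk (G := G.delete i) rfl hl x
  rw [wronsk_eq hi, mu_eq hi]
  simp only [eval_add, eval_mul, eval_finsetSum, eval_C, eval_pow, eval_sub, eval_X]
  have hL : ∀ l, 0 ≤ -G.lam s(i, l) := fun l => neg_nonneg.2 (G.lam_nonpos _)
  set a := (G.delete i).mu.eval x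
  set u := x - G.r i
  set S := ∑ l ∈ G.verts.erase i, -G.lam s(i, l)
  set W := ∑ l ∈ G.verts.erase i, -G.lam s(i, l) * ((G.delete i).wronsk l).eval x
  set T := ∑ l ∈ G.verts.erase i, G.lam s(i, l) * ((G.delete i).delete l).mu.eval x
  have hT : T ^ 2 ≤ S * W := by
    have h1 := Finset.sum_mul_sq_le_sq_mul_sq (G.verts.erase i)
      (fun l => √(-G.lam s(i, l)))
      (fun l => √(-G.lam s(i, l)) * ((G.delete i).delete l).mu.eval x)
    have h2 : ∀ l, √(-G.lam s(i, l)) * (√(-G.lam s(i, l)) * ((G.delete i).delete l).mu.eval x) =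
        -(G.lam s(i, l) * ((G.delete i).delete l).mu.eval x) := fun l => by
      rw [← mul_assoc, Real.mul_self_sqrt (hL l), neg_mul]
    simp only [h2, Finset.sum_neg_distrib, neg_sq, mul_pow, Real.sq_sqrt (hL _)] at h1
    refine h1.trans ?_
    rw [← Finset.sum_neg_distrib]
    exact mul_le_mul_of_nonneg_left
      (Finset.sum_le_sum fun l hl => mul_le_mul_of_nonneg_left (hs l hl) (hL l))
      (Finset.sum_nonneg fun l _ => hL l)
  have hS : 0 ≤ S := Finset.sum_nonneg fun l _ => hL l
  have hW : 0 ≤ W := Finset.sum_nonneg fun l hl =>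
    mul_nonneg (hL l) ((sq_nonneg _).trans (hs l hl))
  -- `(u a + T)² ≤ (u² + S) (a² + W)`, since `T² ≤ S W`
  rcases hS.eq_or_lt with h0 | h0
  · have : T = 0 := by
      rw [← h0, zero_mul] at hT
      exact pow_eq_zero_iff two_ne_zero |>.1 (le_antisymm hT (sq_nonneg _))
    rw [this, ← h0]
    nlinarith [mul_nonneg (sq_nonneg u) hW]
  · refine le_of_mul_le_mul_left ?_ h0
    nlinarith [sq_nonneg (u * T - a * S), mul_le_mul_of_nonneg_left hT hS,
      mul_le_mul_of_nonneg_left hT (sq_nonneg u)]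

theorem mult_le_mult_delete_add_one (G : WGraph V) {i : V} (hi : i ∈ G.verts) (θ : ℝ) :
    G.mult θ ≤ (G.delete i).mult θ + 1 := by
  by_contra! h
  have h1 := le_two_mul_rootMultiplicity (θ := θ) (mu_ne_zero (G.delete i)) (sq_le_wronsk rfl hi)
    (pow_dvd_wronskian (p := G.mu) (q := (G.delete i).mu)
      (n := 2 * (G.delete i).mult θ + 1) (by unfold mult at *; omega))
  unfold mult at *
  omega

theorem mult_delete_le_add_one (G : WGraph V) {i : V} (hi : i ∈ G.verts) (θ : ℝ) :
    (G.delete i).mult θ ≤ G.mult θ + 1 := by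
  by_contra! h
  obtain ⟨c, hc⟩ := exists_sq_le_mul_wronsk hi
  have h1 := le_two_mul_rootMultiplicity (θ := θ) (mu_ne_zero G) hc
    ((pow_dvd_wronskian (p := G.mu) (q := (G.delete i).mu)
      (n := 2 * G.mult θ + 1) (by unfold mult at *; omega)).mul_left c)
  unfold mult at *
  omega

/-! ### Stability under deletion of a frontier vertex -/

theorem pow_dvd_cross {G : WGraph V} {i j : V} {θ : ℝ} {n : ℕ}
    (h1 : n ≤ (G.delete i).mult θ + (G.delete j).mult θ)
    (h2 : n ≤ G.mult θ + ((G.delete i).delete j).mult θ) : (X - C θ) ^ n ∣ G.cross i j :=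
  dvd_sub (pow_dvd_mul_of_le h1) (pow_dvd_mul_of_le h2)

theorem pow_succ_dvd_cross {G : WGraph V} {i j : V} {θ : ℝ} {n : ℕ} (hi : i ∈ G.verts)
    (hj : j ∈ G.verts) (hij : i ≠ j) (hn : Odd n)
    (h1 : n ≤ (G.delete i).mult θ + (G.delete j).mult θ)
    (h2 : n ≤ G.mult θ + ((G.delete i).delete j).mult θ) : (X - C θ) ^ (n + 1) ∣ G.cross i j :=
  pow_succ_dvd_of_nonneg hn (cross_nonneg hi hj hij) (pow_dvd_cross h1 h2)

/-- The order of `cross G i j` at `θ` is even, so an odd order of the first product must be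
compensated by the second one. -/
theorem mult_add_le_of_odd {G : WGraph V} {i j : V} {θ : ℝ} (hi : i ∈ G.verts)
    (hj : j ∈ G.verts) (hij : i ≠ j) (hn : Odd ((G.delete i).mult θ + (G.delete j).mult θ)) :
    G.mult θ + ((G.delete i).delete j).mult θ ≤ (G.delete i).mult θ + (G.delete j).mult θ := by
  by_contra! h
  have h1 := pow_succ_dvd_cross hi hj hij hn le_rfl h.le
  have h2 := (dvd_sub_left (pow_dvd_mul_of_le (p := G.mu) h)).1 h1
  exact (Nat.lt_succ_self _).not_ge
    (le_rootMultiplicity_add (mu_ne_zero _) (mu_ne_zero _) h2)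

theorem le_two_mul_mult {G : WGraph V} {i j : V} {θ : ℝ} {n : ℕ} (hi : i ∈ G.verts)
    (hj : j ∈ G.verts) (hij : i ≠ j) (hlam : G.lam s(i, j) ≠ 0)
    (h : (X - C θ) ^ n ∣ G.cross i j) : n ≤ 2 * ((G.delete i).delete j).mult θ := by
  refine le_two_mul_rootMultiplicity (g := C (-G.lam s(i, j))⁻¹ * G.cross i j) (mu_ne_zero _)
    (fun x => ?_) (h.mul_left _)
  have h1 : 0 < -G.lam s(i, j) := neg_pos.2 (lt_of_le_of_ne (G.lam_nonpos _) hlam)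
  rw [eval_mul, eval_C, inv_mul_eq_div, le_div_iff₀ h1, mul_comm]
  exact edge_le_cross rfl hi hj hij x

/-- An inessential vertex with an essential neighbor raises the multiplicity when deleted. -/
theorem mult_delete_of_adj_essential {G : WGraph V} {i j : V} {θ : ℝ} (hi : i ∈ G.verts)
    (hj : j ∈ G.verts) (hij : i ≠ j) (hlam : G.lam s(i, j) ≠ 0)
    (hess : (G.delete j).mult θ + 1 = G.mult θ) (hine : (G.delete i).mult θ + 1 ≠ G.mult θ) :
    (G.delete i).mult θ = G.mult θ + 1 ∧ ((G.delete i).delete j).mult θ = G.mult θ := by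
  have a1 := mult_le_mult_delete_add_one G hi θ
  have a2 := mult_delete_le_add_one G hi θ
  have a3 := mult_le_mult_delete_add_one (G.delete i) (mem_delete.2 ⟨hij.symm, hj⟩) θ
  have a4 := mult_delete_le_add_one (G.delete j) (mem_delete.2 ⟨hij, hi⟩) θ
  rw [delete_comm G j i] at a4
  have h1 := pow_succ_dvd_cross hi hj hij (θ := θ) (odd_two_mul_add_one ((G.delete j).mult θ))
    (by omega) (by omega)
  have h2 := le_two_mul_mult hi hj hij hlam h1
  have h3 : (G.delete i).mult θ ≠ G.mult θ := fun h => by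
    have := mult_add_le_of_odd hi hj hij (θ := θ) ⟨(G.delete j).mult θ, by omega⟩
    omega
  omega

/-- The coefficient of `-t` in `cross (G.shift k t) i j`. -/
noncomputable def cross₃ (G : WGraph V) (i j k : V) : ℝ[X] :=
  (G.delete j).mu * ((G.delete i).delete k).mu + (G.delete i).mu * ((G.delete j).delete k).mu
    - G.mu * (((G.delete i).delete j).delete k).mu - (G.delete k).mu * ((G.delete i).delete j).mu

/-- The discriminant inequality for the quadratic polynomial `t ↦ cross (G.shift k t) i j`, which
is non-negative. -/
theorem cross₃_sq_le {G : WGraph V} {i j k : V} (hi : i ∈ G.verts) (hj : j ∈ G.verts)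
    (hk : k ∈ G.verts) (hij : i ≠ j) (hik : i ≠ k) (hjk : j ≠ k) (x : ℝ) :
    (G.cross₃ i j k).eval x ^ 2 ≤
      (C 4 * (G.cross i j * (G.delete k).cross i j)).eval x := by
  have h1 : ∀ t : ℝ, 0 ≤ ((G.delete k).cross i j).eval x * (t * t) +
      (-(G.cross₃ i j k).eval x) * t + (G.cross i j).eval x := fun t => by
    refine (cross_nonneg (G := G.shift k t) hi hj hij x).trans_eq ?_
    have e0 := mu_shift hk t
    have e1 : ((G.shift k t).delete i).mu = _ :=
      mu_shift (G := G.delete i) (mem_delete.2 ⟨hik.symm, hk⟩) t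
    have e2 : ((G.shift k t).delete j).mu = _ :=
      mu_shift (G := G.delete j) (mem_delete.2 ⟨hjk.symm, hk⟩) t
    have e3 : (((G.shift k t).delete i).delete j).mu = _ :=
      mu_shift (G := (G.delete i).delete j)
        (mem_delete.2 ⟨hjk.symm, mem_delete.2 ⟨hik.symm, hk⟩⟩) t
    rw [cross, e0, e1, e2, e3, cross, cross, cross₃, delete_comm G k i, delete_comm G k j,
      delete_comm (G.delete i) k j]
    simp only [eval_add, eval_sub, eval_mul, eval_C]
    ring
  have h2 := discrim_le_zero h1
  rw [discrim] at h2
  simp only [eval_mul, eval_C]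
  linarith

/-- Deleting a frontier vertex `i` raises the multiplicity of every `G ∖ k` by one, as it does
for `G` itself. -/
theorem mult_delete_delete_of_adj_essential {G : WGraph V} {i j k : V} {θ : ℝ} (hi : i ∈ G.verts)
    (hj : j ∈ G.verts) (hk : k ∈ G.verts) (hij : i ≠ j) (hik : i ≠ k)
    (hlam : G.lam s(i, j) ≠ 0)
    (hess : (G.delete j).mult θ + 1 = G.mult θ) (hine : (G.delete i).mult θ + 1 ≠ G.mult θ) :
    ((G.delete i).delete k).mult θ = (G.delete k).mult θ + 1 := by
  obtain ⟨hmi, hmij⟩ := mult_delete_of_adj_essential hi hj hij hlam hess hine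
  rcases eq_or_ne j k with rfl | hjk
  · omega
  have mem : ∀ {u v : V}, u ≠ v → u ∈ G.verts → u ∈ (G.delete v).verts :=
    fun h h' => mem_delete.2 ⟨h, h'⟩
  have k1 := mult_le_mult_delete_add_one G hk θ
  have k2 := mult_delete_le_add_one G hk θ
  have ik1 := mult_le_mult_delete_add_one (G.delete i) (mem hik.symm hk) θ
  have ik2 := mult_delete_le_add_one (G.delete k) (mem hik hi) θ
  rw [delete_comm G k i] at ik2
  have jk1 := mult_delete_le_add_one (G.delete j) (mem hjk.symm hk) θ
  have jk2 := mult_le_mult_delete_add_one (G.delete k) (mem hjk hj) θ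
  rw [delete_comm G k j] at jk2
  -- If `j` is essential and `i` inessential in `G ∖ k`, then `i` is a frontier vertex there.
  have frontier : ((G.delete j).delete k).mult θ + 1 = (G.delete k).mult θ →
      ((G.delete i).delete k).mult θ + 1 ≠ (G.delete k).mult θ →
      ((G.delete i).delete k).mult θ = (G.delete k).mult θ + 1 := by
    intro h1 h2
    have := mult_delete_of_adj_essential (G := G.delete k) (mem hik hi) (mem hjk hj) hij hlam
      (θ := θ)
    rw [delete_comm G k j, delete_comm G k i] at this
    exact (this h1 h2).1
  rcases lt_trichotomy ((G.delete k).mult θ) (G.mult θ) with h | h | h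
  · omega
  · refine frontier ?_ (by omega)
    have := mult_add_le_of_odd hj hk hjk (θ := θ) ⟨(G.delete j).mult θ, by omega⟩
    omega
  · refine frontier (by omega) fun hb => ?_
    have ijk1 := mult_le_mult_delete_add_one ((G.delete i).delete j)
      (mem_delete.2 ⟨hjk.symm, mem hik.symm hk⟩) θ
    have ijk2 := mult_delete_le_add_one ((G.delete i).delete j)
      (mem_delete.2 ⟨hjk.symm, mem hik.symm hk⟩) θ
    have cij := pow_dvd_cross (G := G) (i := i) (j := j) (θ := θ) (n := 2 * G.mult θ)
      (by omega) (by omega)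
    have cijk : (X - C θ) ^ (2 * G.mult θ) ∣ (G.delete k).cross i j := by
      apply pow_dvd_cross
      · rw [delete_comm G k i, delete_comm G k j]
        omega
      · rw [delete_comm G k i, delete_comm _ k j]
        omega
    have hc1 : G.mult θ ≤ (((G.delete i).delete j).delete k).mult θ := by
      have := le_two_mul_mult (G := G.delete k) (mem hik hi) (mem hjk hj) hij hlam cijk
      rw [delete_comm G k i, delete_comm _ k j] at this
      omega
    have hc2 : (((G.delete i).delete j).delete k).mult θ ≠ G.mult θ := fun hc => by
      have e1 : ((G.delete j).delete i).mult θ = G.mult θ := by rw [delete_comm, hmij]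
      have e2 : (((G.delete j).delete i).delete k).mult θ = G.mult θ := by
        rw [delete_comm G j i, hc]
      -- in `cross (G ∖ j) i k` only the second product has odd order
      have d := pow_succ_dvd_cross (G := G.delete j) (θ := θ) (mem hij hi) (mem hjk.symm hk) hik
        (odd_two_mul_add_one ((G.delete j).mult θ)) (by omega) (by omega)
      have d2 := (dvd_sub_right (pow_dvd_mul_of_le (p := ((G.delete j).delete i).mu)
        (q := ((G.delete j).delete k).mu) (θ := θ)
        (n := 2 * (G.delete j).mult θ + 1 + 1) (by unfold mult at *; omega))).1 d
      have := le_rootMultiplicity_add (mu_ne_zero _) (mu_ne_zero _) d2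
      unfold mult at *
      omega
    -- The first product in `cross₃` has order `2 m - 1`, the other three have larger order, while
    -- the discriminant inequality requires the order of `cross₃` to be at least `2 m`.
    have hB : ¬ (X - C θ) ^ (2 * G.mult θ) ∣ (G.delete j).mu * ((G.delete i).delete k).mu :=
      fun hd => by
        have := le_rootMultiplicity_add (mu_ne_zero _) (mu_ne_zero _) hd
        unfold mult at *
        omega
    have hrest : ∀ {p q : ℝ[X]}, 2 * G.mult θ ≤ p.rootMultiplicity θ + q.rootMultiplicity θ →
        (X - C θ) ^ (2 * G.mult θ) ∣ p * q := pow_dvd_mul_of_le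
    refine hB ?_
    have h3 : (X - C θ) ^ (2 * G.mult θ) ∣ G.cross₃ i j k := by
      by_cases h0 : G.cross₃ i j k = 0
      · rw [h0]
        exact dvd_zero _
      have h4 := le_two_mul_rootMultiplicity (θ := θ) (n := 2 * G.mult θ + 2 * G.mult θ) h0
        (cross₃_sq_le hi hj hk hij hik hjk) (by
          rw [pow_add]
          exact (mul_dvd_mul cij cijk).mul_left _)
      exact (pow_dvd_pow _ (by omega)).trans (pow_rootMultiplicity_dvd _ θ)
    have r1 := hrest (p := (G.delete i).mu) (q := ((G.delete j).delete k).mu)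
      (by unfold mult at *; omega)
    have r2 := hrest (p := G.mu) (q := (((G.delete i).delete j).delete k).mu)
      (by unfold mult at *; omega)
    have r3 := hrest (p := (G.delete k).mu) (q := ((G.delete i).delete j).mu)
      (by unfold mult at *; omega)
    have h5 := dvd_add (dvd_add h3 (dvd_add r2 r3)) (dvd_neg.2 r1)
    rw [cross₃] at h5
    ring_nf at h5 ⊢
    exact h5

theorem valueAt_alpha_eq_zero_iff {G : WGraph V} {i : V} {θ : ℝ} (hi : i ∈ G.verts) :
    (G.alpha i).valueAt θ = ((0 : ℝ) : OnePoint ℝ) ↔ (G.delete i).mult θ + 1 = G.mult θ := by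
  have := mult_le_mult_delete_add_one G hi θ
  rw [alpha, RatFunc.valueAt_div_eq_zero_iff (mu_ne_zero _) (mu_ne_zero _)]
  unfold mult at *
  omega

theorem valueAt_alpha_eq_infty_iff {G : WGraph V} {i : V} {θ : ℝ} :
    (G.alpha i).valueAt θ = OnePoint.infty ↔ G.mult θ < (G.delete i).mult θ := by
  rw [alpha, RatFunc.valueAt_div_eq_infty_iff (mu_ne_zero _) (mu_ne_zero _)]
  rfl

theorem zeroSet_eq_essentialSet (G : WGraph V) (θ : ℝ) : G.zeroSet θ = G.essentialSet θ := by
  ext i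
  exact and_congr_right valueAt_alpha_eq_zero_iff

/-- Deleting a frontier vertex `i` does not change the value of `α_k`. -/
theorem valueAt_alpha_delete {G : WGraph V} {i j k : V} {θ : ℝ} (hi : i ∈ G.verts)
    (hj : j ∈ G.verts) (hk : k ∈ G.verts) (hij : i ≠ j) (hik : i ≠ k)
    (hlam : G.lam s(i, j) ≠ 0)
    (hess : (G.delete j).mult θ + 1 = G.mult θ) (hine : (G.delete i).mult θ + 1 ≠ G.mult θ) :
    ((G.delete i).alpha k).valueAt θ = (G.alpha k).valueAt θ := by
  obtain ⟨hmi, -⟩ := mult_delete_of_adj_essential hi hj hij hlam hess hine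
  have hmik := mult_delete_delete_of_adj_essential hi hj hk hij hik hlam hess hine
  have hk' : k ∈ (G.delete i).verts := mem_delete.2 ⟨hik.symm, hk⟩
  have k1 := mult_le_mult_delete_add_one G hk θ
  have k2 := mult_delete_le_add_one G hk θ
  rcases lt_trichotomy ((G.delete k).mult θ) (G.mult θ) with h | h | h
  · rw [(valueAt_alpha_eq_zero_iff hk').2 (by omega), (valueAt_alpha_eq_zero_iff hk).2 (by omega)]
  · -- both products in `cross G i k` have order `2 m + 1`, so by parity
    -- `cross G i k` vanishes to order `2 m + 2`
    have hd := pow_succ_dvd_cross hi hk hik (θ := θ) (odd_two_mul_add_one (G.mult θ))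
      (by omega) (by omega)
    refine RatFunc.valueAt_div_congr (mu_ne_zero _) (mu_ne_zero _) (mu_ne_zero _)
      (mu_ne_zero _) (by unfold mult at *; omega) (by unfold mult at *; omega) ?_
    exact (pow_dvd_pow _ (by unfold mult at *; omega)).trans hd
  · rw [valueAt_alpha_eq_infty_iff.2 (by omega), valueAt_alpha_eq_infty_iff.2 (by omega)]

end WGraph

theorem mainTheorem1 {V : Type*} [DecidableEq V] (G : WGraph V) (θ : ℝ) :
    G.zeroSet θ = G.essentialSet θ ∧
    ∀ i ∈ G.boundary (G.zeroSet θ),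
      (∀ j ∈ G.verts, j ≠ i →
        ((G.delete i).alpha j).valueAt θ = (G.alpha j).valueAt θ) ∧
      (G.delete i).negSet θ = G.negSet θ ∧
      (G.delete i).zeroSet θ = G.zeroSet θ ∧
      (G.delete i).posSet θ = G.posSet θ ∧
      (G.delete i).inftySet θ = G.inftySet θ \ {i} := by
  refine ⟨G.zeroSet_eq_essentialSet θ, ?_⟩
  rw [G.zeroSet_eq_essentialSet θ]
  rintro i ⟨hi, hine, j, ⟨hj, hess⟩, -, -, hij, hlam⟩
  replace hine : (G.delete i).mult θ + 1 ≠ G.mult θ := fun h => hine ⟨hi, h⟩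
  have hval : ∀ k ∈ G.verts, k ≠ i →
      ((G.delete i).alpha k).valueAt θ = (G.alpha k).valueAt θ := fun k hk hki =>
    WGraph.valueAt_alpha_delete hi hj hk hij hki.symm hlam hess hine
  have hinf : (G.alpha i).valueAt θ = OnePoint.infty :=
    WGraph.valueAt_alpha_eq_infty_iff.2
      (by have := WGraph.mult_delete_of_adj_essential hi hj hij hlam hess hine; omega)
  -- A condition on the values that excludes `∞` cuts out the same vertices in `G ∖ i` and `G`.
  have key : ∀ P : OnePoint ℝ → Prop, ¬ P OnePoint.infty → ∀ k,
      (k ∈ (G.delete i).verts ∧ P (((G.delete i).alpha k).valueAt θ)) ↔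
        (k ∈ G.verts ∧ P ((G.alpha k).valueAt θ)) := by
    intro P hP k
    rw [WGraph.mem_delete]
    constructor
    · rintro ⟨⟨hki, hk⟩, h⟩
      exact ⟨hk, hval k hk hki ▸ h⟩
    · rintro ⟨hk, h⟩
      have hki : k ≠ i := by
        rintro rfl
        exact hP (hinf ▸ h)
      exact ⟨⟨hki, hk⟩, (hval k hk hki).symm ▸ h⟩
  refine ⟨hval, ?_, ?_, ?_, ?_⟩
  · ext k
    exact key (fun v => ∃ t : ℝ, t < 0 ∧ v = (t : OnePoint ℝ))
      (fun ⟨t, _, h⟩ => OnePoint.infty_ne_coe t h) k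
  · rw [← G.zeroSet_eq_essentialSet θ]
    ext k
    exact key (fun v => v = ((0 : ℝ) : OnePoint ℝ)) (OnePoint.infty_ne_coe 0) k
  · ext k
    exact key (fun v => ∃ t : ℝ, 0 < t ∧ v = (t : OnePoint ℝ))
      (fun ⟨t, _, h⟩ => OnePoint.infty_ne_coe t h) k
  · ext k
    simp only [WGraph.inftySet, Set.mem_ofPred_eq, Set.mem_sdiff, Set.mem_singleton_iff,
      WGraph.mem_delete]
    constructor
    · rintro ⟨⟨hki, hk⟩, h⟩
      exact ⟨⟨hk, hval k hk hki ▸ h⟩, hki⟩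
    · rintro ⟨⟨hk, h⟩, hki⟩
      exact ⟨⟨hki, hk⟩, (hval k hk hki).trans h⟩
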